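/- Let $N\ge 2$ and $L\ge 1$ be integers and let $q$ be a real number with $0<q<1$. For $r\ge 1$ put $$A_r^{(N,L)}(q)=\sum_{0<m_1<\cdots<m_r}\left(\frac{q^{(N-1)(m_1+\cdots+m_r)}}{(1-q^{m_1})^N\cdots(1-q^{m_r})^N}\right)^{L},$$ and for $k\ge 1$ put $G_k(q)=\sum_{n\ge 1}\sigma_{k-1}(n)q^n$, where $\sigma_a(n)=\sum_{d\mid n}d^a$. For $n\ge 1$ put $H_0(n)=1$ and $H_r(n)=\sum_{0<m_1<\cdots<m_r<n}\frac{1}{m_1\cdots m_r}$ for $r\ge 1$ (so $H_r(n)=0$ for $r\ge n$), and for $m\ge 0$, $n_1,n_2\ge 1$ put $$C_m(n_1,n_2)=\sum_{a=0}^{m}(-1)^{m-a}H_a(n_1)H_{m-a}(n_2).$$ Then the series defining $A_r^{(N,L)}(q)$ $(r\ge 1)$ and $G_k(q)$ $(k\ge 1)$ converge absolutely, and in the ring $\mathbb{R}[[X]]$ of formal power series $$1+\sum_{r\ge 1}(-1)^{((N-1)L-1)r}A_r^{(N,L)}(q)X^r=\exp\left(\frac{N}{(N-1)L}\sum_{n\ge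 1}\frac{X^n}{n^2\binom{NLn}{Ln}}\sum_{k=2}^{NLn}C_{k-2}(Ln,(N-1)Ln)\,G_k(q)\right).$$ -/

import Mathlib

noncomputable section

namespace QSeries

/-- The index set of the sum over `0 < m₁ < ⋯ < m_r`: strictly increasing `r`-tuples of positive
integers. -/
def IncTuple (r : ℕ) : Type :=
  {m : Fin r → ℕ // StrictMono m ∧ ∀ i, 0 < m i}

/-- The summand `(q^{(N-1)(m₁+⋯+m_r)} / ((1-q^{m₁})^N ⋯ (1-q^{m_r})^N))^L`.
It is used for `N ≥ 2` only, so the natural number `N - 1` is the true difference. -/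
def ATerm (N L r : ℕ) (q : ℝ) (m : IncTuple r) : ℝ :=
  (q ^ ((N - 1) * ∑ i, m.1 i) / ∏ i, (1 - q ^ m.1 i) ^ N) ^ L

/-- `A_r^{(N,L)}(q)`. -/
def A (N L r : ℕ) (q : ℝ) : ℝ := ∑' m : IncTuple r, ATerm N L r q m

/-- `G_k(q) = ∑_{n ≥ 1} σ_{k-1}(n) q^n` (for `k ≥ 1`), where `σ_a(n) = ∑_{d ∣ n} d^a`. -/
def G (k : ℕ) (q : ℝ) : ℝ :=
  ∑' n : ℕ+, (ArithmeticFunction.sigma (k - 1) (n : ℕ) : ℝ) * q ^ (n : ℕ)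

/-- `H_r(n) = ∑_{0 < m₁ < ⋯ < m_r < n} 1 / (m₁ ⋯ m_r)`, with `H_0(n) = 1`: the tuples are given by
their underlying `r`-element subsets of `{1, …, n-1}`. -/
def H (r n : ℕ) : ℝ :=
  ∑ s ∈ (Finset.Ioo 0 n).powersetCard r, 1 / ∏ m ∈ s, (m : ℝ)

/-- `C_m(n₁, n₂) = ∑_{a=0}^m (-1)^{m-a} H_a(n₁) H_{m-a}(n₂)`. -/
def C (m n₁ n₂ : ℕ) : ℝ :=
  ∑ a ∈ Finset.range (m + 1), (-1) ^ (m - a) * H a n₁ * H (m - a) n₂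

/-- The formal power series `1 + ∑_{r ≥ 1} (-1)^{((N-1)L-1) r} A_r^{(N,L)}(q) X^r`. -/
def genSeries (N L : ℕ) (q : ℝ) : PowerSeries ℝ :=
  PowerSeries.mk fun r => if r = 0 then 1 else (-1) ^ (((N - 1) * L - 1) * r) * A N L r q

/-- The formal power series
`N/((N-1)L) ∑_{n ≥ 1} X^n / (n² binom(NLn, Ln)) ∑_{k=2}^{NLn} C_{k-2}(Ln, (N-1)Ln) G_k(q)`,
which has no constant term. -/
def exponent (N L : ℕ) (q : ℝ) : PowerSeries ℝ :=
  PowerSeries.mk fun n => if n = 0 then 0 else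
    (N : ℝ) / (((N : ℝ) - 1) * L) * (1 / ((n : ℝ) ^ 2 * ((N * L * n).choose (L * n) : ℝ)) *
      ∑ k ∈ Finset.Icc 2 (N * L * n), C (k - 2) (L * n) ((N - 1) * L * n) * G k q)

/-- `exp(f) = ∑_{n ≥ 0} f^n / n!` for a formal power series `f` without constant term. -/
def formalExp (f : PowerSeries ℝ) : PowerSeries ℝ := (PowerSeries.exp ℝ).subst f

end QSeries

end

namespace QSeries

open Filter Topology Finset

/-! Up to sign, the left side is the generating series of the elementary symmetric functions of y_m
= `factor N L q m`, so by Newton its logarithm is governed by the power sums ∑ y_m^n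
(`elementary_eq_exp_powerSums`).

With t = q^m, a = Ln, b = (N-1)Ln one has y_m^n = t^b/(1-t)^(a+b) = ∑_d binom(d+a-1, a+b-1) t^d. The
binomial is a polynomial in d divisible by d, whose coefficients are the C_{k-2}(a,b) up to a
constant (`cast_choose_eq_sum_C`). Since ∑_{m,d} d^(k-1) q^(md) = G_k, the power sums are
combinations of the G_k (`hasSum_pow_div_one_sub_pow`). -/

/-! ### Elementary symmetric functions and power sums -/

/-- A power series over `ℝ` is determined by its constant term and its logarithmic derivative. -/
theorem eq_of_derivative_eq_mul {F K D : PowerSeries ℝ}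
    (hF : PowerSeries.derivative ℝ F = F * D) (hK : PowerSeries.derivative ℝ K = K * D)
    (h0 : PowerSeries.coeff 0 F = PowerSeries.coeff 0 K) : F = K := by
  ext n
  induction n using Nat.strong_induction_on with
  | _ n ih =>
    rcases n with _ | n
    · exact h0
    · have h1 := congrArg (PowerSeries.coeff n) hF
      have h2 := congrArg (PowerSeries.coeff n) hK
      rw [PowerSeries.coeff_derivative, PowerSeries.coeff_mul] at h1 h2
      have h3 : ∑ p ∈ antidiagonal n, PowerSeries.coeff p.1 F * PowerSeries.coeff p.2 D =
          ∑ p ∈ antidiagonal n, PowerSeries.coeff p.1 K * PowerSeries.coeff p.2 D := by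
        refine sum_congr rfl fun p hp => ?_
        rw [ih p.1 (by have := mem_antidiagonal.1 hp; omega)]
      rw [h3, ← h2] at h1
      exact mul_right_cancel₀ (by positivity) h1

/-- The finite product `∏ (1 + w i X)`. -/
noncomputable def finProd {ι : Type*} (w : ι → ℝ) (s : Finset ι) : PowerSeries ℝ :=
  ∏ i ∈ s, (1 + PowerSeries.C (w i) * PowerSeries.X)

/-- The logarithmic derivative of `finProd w s`. -/
noncomputable def finLogDeriv {ι : Type*} (w : ι → ℝ) (s : Finset ι) : PowerSeries ℝ :=
  PowerSeries.mk fun n => ∑ i ∈ s, (-1) ^ n * w i ^ (n + 1)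

theorem one_add_mul_geometric (x : ℝ) :
    (1 + PowerSeries.C x * PowerSeries.X) * PowerSeries.mk (fun n => (-1) ^ n * x ^ (n + 1)) =
      PowerSeries.C x := by
  ext n
  rw [add_mul, one_mul, map_add, mul_assoc, PowerSeries.coeff_C_mul]
  rcases n with _ | n
  · simp
  · rw [mul_comm, PowerSeries.coeff_succ_X_mul]
    simp
    ring

theorem derivative_finProd {ι : Type*} (w : ι → ℝ) (s : Finset ι) :
    PowerSeries.derivative ℝ (finProd w s) = finProd w s * finLogDeriv w s := by
  classical
  induction s using Finset.induction_on with
  | empty =>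
    have : finLogDeriv w ∅ = 0 := by ext; simp [finLogDeriv]
    simp [this, finProd]
  | insert i s hi ih =>
    have h1 : finProd w (insert i s) =
        (1 + PowerSeries.C (w i) * PowerSeries.X) * finProd w s := by
      simp [finProd, prod_insert hi]
    have h2 : finLogDeriv w (insert i s) =
        PowerSeries.mk (fun n => (-1) ^ n * w i ^ (n + 1)) + finLogDeriv w s := by
      ext n; simp [finLogDeriv, sum_insert hi]
    have h3 : PowerSeries.derivative ℝ (1 + PowerSeries.C (w i) * PowerSeries.X) =
        PowerSeries.C (w i) := by
      ext n
      rw [PowerSeries.coeff_derivative]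
      rcases n with _ | n <;> simp [PowerSeries.coeff_one, PowerSeries.coeff_C]
    rw [h1, h2, Derivation.leibniz, ih, h3, smul_eq_mul, smul_eq_mul]
    linear_combination (-finProd w s) * one_add_mul_geometric (w i)

theorem coeff_finProd {ι : Type*} (w : ι → ℝ) (s : Finset ι) (r : ℕ) :
    PowerSeries.coeff r (finProd w s) =
      ∑ t ∈ s.powerset, if #t = r then ∏ i ∈ t, w i else 0 := by
  rw [finProd, prod_one_add, map_sum]
  refine sum_congr rfl fun t _ => ?_
  rw [prod_mul_distrib, prod_const, ← map_prod, PowerSeries.coeff_C_mul, PowerSeries.coeff_X_pow]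
  simp [eq_comm]

/-- Dominated by the products over all finite subsets, summable by absolute convergence of w. -/
theorem summable_prod_of_card {ι : Type*} {w : ι → ℝ} (hw : Summable w) (r : ℕ) :
    Summable fun t : Finset ι => if #t = r then ∏ i ∈ t, w i else 0 := by
  refine Summable.of_norm_bounded (summable_finsetProd_of_summable_norm hw.norm).norm fun t => ?_
  split_ifs
  · exact le_rfl
  · rw [norm_zero]; exact norm_nonneg _

theorem summable_pow_succ {ι : Type*} {w : ι → ℝ} (hw : Summable w) (n : ℕ) :
    Summable fun i => w i ^ (n + 1) := by
  induction n with
  | zero => simpa using hw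
  | succ n ih =>
    simp_rw [pow_succ _ (n + 1)]
    -- Restrict the summable double family to the diagonal.
    exact (summable_mul_of_summable_norm ih.norm hw.norm).comp_injective
      (i := fun i : ι => (i, i)) (fun a b h => (Prod.ext_iff.1 h).1)

/-- `∑ e_r X^r = exp (∑ (-1)^(n-1) p_n X^n / n)` for the elementary symmetric functions and the power
sums of a summable family. -/
theorem elementary_eq_exp_powerSums {ι : Type*} {w : ι → ℝ} (hw : Summable w)
    {E : PowerSeries ℝ} (hE0 : PowerSeries.constantCoeff E = 0)
    (hE : ∀ n : ℕ, PowerSeries.coeff (n + 1) E * (n + 1) = (-1) ^ n * ∑' i, w i ^ (n + 1)) :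
    (PowerSeries.mk fun r => ∑' t : Finset ι, if #t = r then ∏ i ∈ t, w i else 0) =
      (PowerSeries.exp ℝ).subst E := by
  have hs := PowerSeries.HasSubst.of_constantCoeff_zero' hE0
  have hlim : ∀ r, Tendsto (fun s => PowerSeries.coeff r (finProd w s)) atTop
      (𝓝 (∑' t : Finset ι, if #t = r then ∏ i ∈ t, w i else 0)) := by
    intro r
    simp_rw [coeff_finProd]
    exact (summable_prod_of_card hw r).hasSum.comp tendsto_finset_powerset_atTop_atTop
  refine eq_of_derivative_eq_mul (D := PowerSeries.derivative ℝ E) ?_ ?_ ?_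
  · ext n
    rw [PowerSeries.coeff_derivative, PowerSeries.coeff_mul]
    simp only [PowerSeries.coeff_mk, PowerSeries.coeff_derivative, hE]
    -- Each coefficient of F' = F·E' is a finite identity, so it passes from the finite products to
    -- the limit.
    refine tendsto_nhds_unique ((hlim (n + 1)).mul_const _) ?_
    have h : ∀ s, PowerSeries.coeff (n + 1) (finProd w s) * ((n : ℝ) + 1) =
        ∑ p ∈ antidiagonal n, PowerSeries.coeff p.1 (finProd w s) *
          ∑ i ∈ s, (-1) ^ p.2 * w i ^ (p.2 + 1) := fun s => by
      rw [← PowerSeries.coeff_derivative, derivative_finProd, PowerSeries.coeff_mul]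
      simp [finLogDeriv]
    simp_rw [h]
    refine tendsto_finsetSum _ fun p _ => (hlim p.1).mul ?_
    exact (summable_pow_succ hw p.2).hasSum.mul_left _
  · rw [PowerSeries.derivative_subst hs, PowerSeries.derivative_exp]
  · rw [PowerSeries.coeff_mk, PowerSeries.coeff_zero_eq_constantCoeff_apply]
    have h1 : PowerSeries.constantCoeff ((PowerSeries.exp ℝ).subst E) = 1 := by
      have := PowerSeries.constantCoeff_subst_eq_zero hE0 (PowerSeries.exp ℝ - 1) (by simp)
      rw [PowerSeries.subst_sub hs] at this
      have h2 : PowerSeries.subst E (1 : PowerSeries ℝ) = (1 : PowerSeries ℝ) := by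
        rw [← PowerSeries.coe_substAlgHom hs, map_one]
      rw [h2, map_sub, map_one, sub_eq_zero] at this
      exact this
    rw [h1, tsum_eq_single ∅ (fun t ht => by simp [card_eq_zero, ht])]
    simp

/-! ### Binomial coefficients as polynomials in d -/

/-- `∏_{0<i<n} (1 + c X / i)` as a polynomial. -/
noncomputable def risingPoly (c : ℝ) (n : ℕ) : Polynomial ℝ :=
  ∏ i ∈ Ioo 0 n, (1 + Polynomial.C (c / i) * Polynomial.X)

theorem coeff_risingPoly (c : ℝ) (n r : ℕ) : (risingPoly c n).coeff r = c ^ r * H r n := by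
  rw [risingPoly, prod_one_add, Polynomial.finsetSum_coeff, H, mul_sum, powersetCard_eq_filter,
    sum_filter]
  refine sum_congr rfl fun t _ => ?_
  rw [prod_mul_distrib, prod_const, ← map_prod, Polynomial.coeff_C_mul, Polynomial.coeff_X_pow,
    prod_div_distrib, prod_const]
  split_ifs with h1 h2 h2
  · rw [h1]; ring
  · exact absurd h1.symm h2
  · exact absurd h2.symm h1
  · simp

theorem natDegree_risingPoly (c : ℝ) (n : ℕ) : (risingPoly c n).natDegree ≤ n - 1 := by
  refine (Polynomial.natDegree_prod_le _ _).trans ((sum_le_card_nsmul _ _ 1 fun i _ => ?_).trans ?_)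
  · compute_degree
  · simp

theorem eval_risingPoly (c : ℝ) (n : ℕ) (x : ℝ) :
    (risingPoly c n).eval x = ∏ i ∈ Ioo 0 n, (1 + c * x / i) := by
  rw [risingPoly, Polynomial.eval_prod]
  refine prod_congr rfl fun i _ => ?_
  simp
  ring

theorem coeff_risingPoly_mul (a b m : ℕ) :
    (risingPoly 1 a * risingPoly (-1) b).coeff m = C m a b := by
  rw [Polynomial.coeff_mul, C, Nat.sum_antidiagonal_eq_sum_range_succ_mk]
  refine sum_congr rfl fun i _ => ?_
  simp only [coeff_risingPoly]
  ring

/-- `∏_{0<i<a} (1 + x/i) ∏_{0<j<b} (1 - x/j)` expands with the coefficients `C_m(a, b)`. -/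
theorem prod_mul_prod_eq_sum_C {a b : ℕ} (ha : 1 ≤ a) (hb : 1 ≤ b) (x : ℝ) :
    (∏ i ∈ Ioo 0 a, (1 + x / i)) * ∏ j ∈ Ioo 0 b, (1 - x / j) =
      ∑ k ∈ Icc 2 (a + b), C (k - 2) a b * x ^ (k - 2) := by
  have h1 : (risingPoly 1 a * risingPoly (-1) b).natDegree < a + b - 1 := by
    have := natDegree_risingPoly 1 a
    have := natDegree_risingPoly (-1) b
    have := Polynomial.natDegree_mul_le (p := risingPoly 1 a) (q := risingPoly (-1) b)
    omega
  have h2 := Polynomial.eval_eq_sum_range' h1 x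
  rw [Polynomial.eval_mul, eval_risingPoly, eval_risingPoly] at h2
  simp_rw [coeff_risingPoly_mul] at h2
  have h3 : ∀ j : ℕ, 1 + -1 * x / (j : ℝ) = 1 - x / j := fun j => by ring
  simp_rw [h3, one_mul] at h2
  rw [h2]
  refine sum_nbij' (fun i => i + 2) (fun k => k - 2) ?_ ?_ ?_ ?_ ?_ <;> simp <;> omega

theorem cast_ascFactorial_eq_prod (d a : ℕ) :
    (d.ascFactorial (a + 1) : ℝ) = d * a.factorial * ∏ i ∈ Ioo 0 (a + 1), (1 + (d : ℝ) / i) := by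
  induction a with
  | zero => simp [show Ioo 0 1 = ∅ from rfl, Nat.ascFactorial_succ]
  | succ a ih =>
    have h : Ioo 0 (a + 1 + 1) = insert (a + 1) (Ioo 0 (a + 1)) := by
      ext; simp only [mem_Ioo, mem_insert]; omega
    rw [h, prod_insert (by simp), Nat.ascFactorial_succ, Nat.factorial_succ]
    push_cast
    rw [ih]
    field_simp
    ring

theorem cast_descFactorial_eq_prod (d b : ℕ) :
    (d.descFactorial b : ℝ) =
      (-1) ^ b * b.factorial * ∏ j ∈ Ioo 0 (b + 1), (1 - ((d : ℝ) + 1) / j) := by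
  induction b with
  | zero => simp [show Ioo 0 1 = ∅ from rfl]
  | succ b ih =>
    have h : Ioo 0 (b + 1 + 1) = insert (b + 1) (Ioo 0 (b + 1)) := by
      ext; simp only [mem_Ioo, mem_insert]; omega
    -- Truncated subtraction is harmless: the falling factorial vanishes when d < b.
    have h2 : (((d - b : ℕ) : ℝ)) * d.descFactorial b = ((d : ℝ) - b) * d.descFactorial b := by
      rcases le_or_gt b d with hbd | hbd
      · rw [Nat.cast_sub hbd]
      · simp [Nat.descFactorial_of_lt hbd]
    rw [h, prod_insert (by simp), Nat.descFactorial_succ, Nat.factorial_succ]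
    push_cast
    rw [h2, ih]
    field_simp
    ring

/-- The constant in the expansion of the binomial coefficient `binom(d+a-1, a+b-1)`. -/
noncomputable def binomConst (a b : ℕ) : ℝ :=
  (-1) ^ (b - 1) * (a - 1).factorial * (b - 1).factorial / (a + b - 1).factorial

/-- (a+b-1)! times the binomial is d ∏_{0<i<a}(d+i) ∏_{0<j<b}(d-j). The lone factor d raises the
exponent k-2 to k-1. -/
theorem cast_choose_eq_sum_C {a b d : ℕ} (ha : 1 ≤ a) (hb : 1 ≤ b) (hd : 1 ≤ d) :
    ((d + a - 1).choose (a + b - 1) : ℝ) =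
      binomConst a b * ∑ k ∈ Icc 2 (a + b), C (k - 2) a b * (d : ℝ) ^ (k - 1) := by
  obtain ⟨a, rfl⟩ := Nat.exists_eq_add_of_le' ha
  obtain ⟨b, rfl⟩ := Nat.exists_eq_add_of_le' hb
  obtain ⟨d, rfl⟩ := Nat.exists_eq_add_of_le' hd
  have h1 : ∑ k ∈ Icc 2 (a + 1 + (b + 1)), C (k - 2) (a + 1) (b + 1) * ((d + 1 : ℕ) : ℝ) ^ (k - 1) =
      (d + 1 : ℕ) * ∑ k ∈ Icc 2 (a + 1 + (b + 1)),
        C (k - 2) (a + 1) (b + 1) * ((d + 1 : ℕ) : ℝ) ^ (k - 2) := by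
    rw [mul_sum]
    refine sum_congr rfl fun k hk => ?_
    have : k - 1 = k - 2 + 1 := by have := (mem_Icc.1 hk).1; omega
    rw [this]
    ring
  have h2 : (d + 1 + a).descFactorial (a + 1 + b) =
      d.descFactorial b * (d + 1).ascFactorial (a + 1) := by
    have := Nat.descFactorial_mul_descFactorial (k := a + 1) (m := a + 1 + b) (n := d + 1 + a)
      (by omega)
    rw [← this, show d + 1 + a - (a + 1) = d by omega, show a + 1 + b - (a + 1) = b by omega,
      show d + 1 + a = d + (a + 1) by omega, Nat.add_descFactorial_eq_ascFactorial]
  have h3 : ((d + 1 + a).choose (a + 1 + b) : ℝ) * (a + 1 + b).factorial =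
      (d + 1 + a).descFactorial (a + 1 + b) := by
    rw [Nat.descFactorial_eq_factorial_mul_choose]
    push_cast
    ring
  rw [h1, ← prod_mul_prod_eq_sum_C ha hb]
  rw [h2] at h3
  push_cast at h3 ⊢
  rw [cast_ascFactorial_eq_prod, cast_descFactorial_eq_prod] at h3
  have e1 : d + 1 + (a + 1) - 1 = d + 1 + a := by omega
  have e2 : a + 1 + (b + 1) - 1 = a + 1 + b := by omega
  simp only [binomConst, e1, e2, Nat.add_sub_cancel]
  rw [← mul_div_right_comm, eq_div_iff (by positivity), h3]
  push_cast
  ring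

/-! ### Lambert series and the G_k -/

theorem hasSum_choose_mul_pow {a b : ℕ} (ha : 1 ≤ a) (hb : 1 ≤ b) {t : ℝ} (ht : |t| < 1) :
    HasSum (fun d : ℕ+ => (((d : ℕ) + a - 1).choose (a + b - 1) : ℝ) * t ^ (d : ℕ))
      (t ^ b / (1 - t) ^ (a + b)) := by
  have h := (hasSum_choose_mul_geometric_of_norm_lt_one (a + b - 1)
    (r := t) (by simpa using ht)).mul_left (t ^ b)
  rw [mul_one_div, show a + b - 1 + 1 = a + b by omega] at h
  -- Shift by b: the omitted terms 0 < d < b have zero binomial coefficient.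
  let e : ℕ → ℕ+ := fun n => ⟨n + b, by omega⟩
  have he : Function.Injective e := fun m n h => by
    have := congrArg PNat.val h
    simpa [e] using this
  rw [← he.hasSum_iff]
  · convert! h using 2 with n
    simp only [Function.comp, e, PNat.mk_coe]
    rw [show n + b + a - 1 = n + (a + b - 1) by omega]
    ring
  · intro d hd
    rw [Nat.choose_eq_zero_of_lt]
    · simp
    · by_contra hlt
      refine hd ⟨d - b, PNat.eq ?_⟩
      have := d.pos
      simp only [e, PNat.mk_coe]
      omega

theorem hasSum_pow_mul_pow_G {q : ℝ} (hq : |q| < 1) {k : ℕ} :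
    HasSum (fun c : ℕ+ × ℕ+ => (c.2 : ℝ) ^ (k - 1) * q ^ (c.1 * c.2 : ℕ)) (G k q) := by
  have h := summable_prod_mul_pow (k - 1) (r := q) (by simpa using hq)
  have h2 := tsum_prod_pow_eq_tsum_sigma (k - 1) (r := q) (by simpa using hq)
  rw [G, ← h2, ← h.tsum_prod]
  exact h.hasSum

/-- One double series over (m, d), evaluated as a whole and by first summing over d. -/
theorem hasSum_pow_div_one_sub_pow {a b : ℕ} (ha : 1 ≤ a) (hb : 1 ≤ b) {q : ℝ} (hq : |q| < 1) :
    HasSum (fun m : ℕ+ => (q ^ (m : ℕ)) ^ b / (1 - q ^ (m : ℕ)) ^ (a + b))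
      (binomConst a b * ∑ k ∈ Icc 2 (a + b), C (k - 2) a b * G k q) := by
  have h : HasSum (fun c : ℕ+ × ℕ+ =>
      (((c.2 : ℕ) + a - 1).choose (a + b - 1) : ℝ) * (q ^ (c.1 : ℕ)) ^ (c.2 : ℕ))
      (binomConst a b * ∑ k ∈ Icc 2 (a + b), C (k - 2) a b * G k q) := by
    have h1 := (hasSum_sum (s := Icc 2 (a + b)) fun k _ =>
      (hasSum_pow_mul_pow_G hq (k := k)).mul_left (C (k - 2) a b)).mul_left (binomConst a b)
    refine h1.congr_fun fun c => ?_
    rw [cast_choose_eq_sum_C ha hb c.2.pos, mul_assoc, sum_mul]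
    congr 1
    refine sum_congr rfl fun k _ => ?_
    rw [← pow_mul, mul_assoc]
  refine h.prod_fiberwise fun m => hasSum_choose_mul_pow ha hb ?_
  rw [abs_pow]
  exact pow_lt_one₀ (abs_nonneg q) hq m.pos.ne'

theorem summable_sigma_mul_pow {q : ℝ} (hq0 : 0 ≤ q) (hq1 : q < 1) (k : ℕ) :
    Summable fun n : ℕ+ => (ArithmeticFunction.sigma k (n : ℕ) : ℝ) * q ^ (n : ℕ) := by
  have h := (summable_pow_mul_geometric_of_norm_lt_one (k + 1) (r := q)
    (by rwa [Real.norm_of_nonneg hq0])).comp_injective PNat.coe_injective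
  refine Summable.of_nonneg_of_le (fun n => by positivity) (fun n => ?_) h
  refine mul_le_mul_of_nonneg_right ?_ (by positivity)
  exact_mod_cast ArithmeticFunction.sigma_le_pow_succ k n

/-! ### Increasing tuples as finite sets -/

/-- An increasing tuple as an embedding into the positive integers. -/
def IncTuple.toEmbedding {r : ℕ} (m : IncTuple r) : Fin r ↪ ℕ+ :=
  ⟨fun i => ⟨m.1 i, m.2.2 i⟩, fun _ _ h => m.2.1.injective (congrArg PNat.val h)⟩

theorem IncTuple.coe_toEmbedding {r : ℕ} (m : IncTuple r) (i : Fin r) :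
    (m.toEmbedding i : ℕ) = m.1 i :=
  rfl

/-- The underlying set of an increasing tuple. -/
def IncTuple.toFinset {r : ℕ} (m : IncTuple r) : Finset ℕ+ :=
  univ.map m.toEmbedding

theorem IncTuple.card_toFinset {r : ℕ} (m : IncTuple r) : #m.toFinset = r := by
  simp [IncTuple.toFinset]

theorem IncTuple.prod_toFinset {r : ℕ} (m : IncTuple r) (f : ℕ → ℝ) :
    ∏ i ∈ m.toFinset, f i = ∏ i, f (m.1 i) := by
  simp [IncTuple.toFinset, IncTuple.coe_toEmbedding]

theorem IncTuple.toFinset_injective {r : ℕ} :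
    Function.Injective (IncTuple.toFinset (r := r)) := by
  intro m m' h
  refine Subtype.ext ((m.2.1.range_inj m'.2.1).1 ?_)
  have h2 : ∀ m : IncTuple r, Set.range m.1 = (fun n : ℕ+ => (n : ℕ)) '' m.toFinset := fun m => by
    ext x; simp [IncTuple.toFinset, IncTuple.coe_toEmbedding]
  rw [h2, h2, h]

theorem IncTuple.exists_toFinset_eq {r : ℕ} {t : Finset ℕ+} (ht : #t = r) :
    ∃ m : IncTuple r, m.toFinset = t := by
  refine ⟨⟨fun i => t.orderEmbOfFin ht i, fun i j h => ?_, fun i => PNat.pos _⟩, ?_⟩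
  · exact_mod_cast (t.orderEmbOfFin ht).strictMono h
  · refine coe_injective ?_
    rw [← t.range_orderEmbOfFin ht]
    unfold IncTuple.toFinset
    rw [coe_map, coe_univ, Set.image_univ]
    rfl

theorem hasSum_incTuple {y : ℕ → ℝ} (hy : Summable fun n : ℕ+ => y n) (r : ℕ) :
    HasSum (fun m : IncTuple r => ∏ i, y (m.1 i))
      (∑' t : Finset ℕ+, if #t = r then ∏ i ∈ t, y i else 0) := by
  have h := (summable_prod_of_card hy r).hasSum
  rw [← IncTuple.toFinset_injective.hasSum_iff] at h
  · refine h.congr_fun fun m => ?_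
    simp [IncTuple.card_toFinset, IncTuple.prod_toFinset]
  · intro t ht
    exact if_neg fun hc => ht (IncTuple.exists_toFinset_eq hc)

/-! ### Power sums of the factors -/

/-- The factor of `ATerm` belonging to a single index. -/
noncomputable def factor (N L : ℕ) (q : ℝ) (m : ℕ) : ℝ :=
  (q ^ ((N - 1) * m) / (1 - q ^ m) ^ N) ^ L

theorem ATerm_eq_prod (N L r : ℕ) (q : ℝ) (m : IncTuple r) :
    ATerm N L r q m = ∏ i, factor N L q (m.1 i) := by
  unfold ATerm factor
  symm
  rw [prod_pow, prod_div_distrib, prod_pow_eq_pow_sum, mul_sum]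

theorem factor_pow (N L : ℕ) (hN : 1 ≤ N) (q : ℝ) (m n : ℕ) :
    factor N L q m ^ n = (q ^ m) ^ ((N - 1) * L * n) /
      (1 - q ^ m) ^ (L * n + (N - 1) * L * n) := by
  obtain ⟨N, rfl⟩ := Nat.exists_eq_add_of_le' hN
  simp only [factor, Nat.add_sub_cancel, div_pow, ← pow_mul]
  congr 2 <;> ring

/-- For a = Ln, b = (N-1)Ln the ratio (a+b)/(ab) is N/((N-1)Ln); the logarithm supplies the second
1/n. -/
theorem binomConst_eq {a b : ℕ} (ha : 1 ≤ a) (hb : 1 ≤ b) :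
    binomConst a b = (-1) ^ (b - 1) * ((a + b) / (a * b)) / ((a + b).choose a : ℝ) := by
  obtain ⟨a, rfl⟩ := Nat.exists_eq_add_of_le' ha
  obtain ⟨b, rfl⟩ := Nat.exists_eq_add_of_le' hb
  have h := Nat.choose_mul_factorial_mul_factorial (Nat.le_add_right (a + 1) (b + 1))
  rw [Nat.add_sub_cancel_left] at h
  have h' : ((a + 1 + (b + 1)).choose (a + 1) : ℝ) * (a + 1).factorial * (b + 1).factorial =
    (a + 1 + (b + 1)).factorial := by exact_mod_cast h
  have hpos : ((a + 1 + (b + 1)).choose (a + 1) : ℝ) ≠ 0 := by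
    exact_mod_cast (Nat.choose_pos (by omega)).ne'
  rw [show a + 1 + (b + 1) = a + b + 1 + 1 by omega] at h' hpos ⊢
  rw [Nat.factorial_succ a, Nat.factorial_succ b, Nat.factorial_succ (a + b + 1)] at h'
  simp only [binomConst, show a + 1 + (b + 1) - 1 = a + b + 1 by omega, Nat.add_sub_cancel]
  rw [div_eq_div_iff (by positivity) hpos]
  push_cast at h' ⊢
  field_simp
  linear_combination h'

theorem hasSum_factor_pow {N L n : ℕ} (hN : 2 ≤ N) (hL : 1 ≤ L) (hn : 1 ≤ n) {q : ℝ}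
    (hq : |q| < 1) :
    HasSum (fun m : ℕ+ => factor N L q m ^ n)
      (binomConst (L * n) ((N - 1) * L * n) *
        ∑ k ∈ Icc 2 (N * L * n), C (k - 2) (L * n) ((N - 1) * L * n) * G k q) := by
  have ha : 1 ≤ L * n := Nat.mul_pos hL hn
  have hb : 1 ≤ (N - 1) * L * n := Nat.mul_pos (Nat.mul_pos (by omega) hL) hn
  have h := hasSum_pow_div_one_sub_pow ha hb hq
  simp_rw [← factor_pow N L (by omega)] at h
  have hab : L * n + (N - 1) * L * n = N * L * n := by
    obtain ⟨N, rfl⟩ := Nat.exists_eq_add_of_le' (show 1 ≤ N by omega)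
    rw [Nat.add_sub_cancel]
    ring
  rwa [hab] at h

end QSeries

theorem corollary4p7 (N L : ℕ) (hN : 2 ≤ N) (hL : 1 ≤ L) (q : ℝ) (hq0 : 0 < q) (hq1 : q < 1) :
    (∀ r : ℕ, 1 ≤ r → Summable (QSeries.ATerm N L r q)) ∧
    (∀ k : ℕ, 1 ≤ k → Summable fun n : ℕ+ =>
      (ArithmeticFunction.sigma (k - 1) (n : ℕ) : ℝ) * q ^ (n : ℕ)) ∧
    QSeries.genSeries N L q = QSeries.formalExp (QSeries.exponent N L q) := by
  have hq : |q| < 1 := by rwa [abs_of_pos hq0]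
  have hy : Summable fun m : ℕ+ => QSeries.factor N L q m := by
    simpa using (QSeries.hasSum_factor_pow hN hL le_rfl hq).summable
  have hA := fun r => QSeries.hasSum_incTuple hy r
  simp_rw [← QSeries.ATerm_eq_prod] at hA
  refine ⟨fun r _ => (hA r).summable, fun k _ => QSeries.summable_sigma_mul_pow hq0.le hq1 _, ?_⟩
  -- Scaling the weights by ε multiplies the r-th elementary function by ε^r.
  set ε : ℝ := (-1) ^ ((N - 1) * L - 1) with hε
  have h := QSeries.elementary_eq_exp_powerSums (hy.mul_left ε) (E := QSeries.exponent N L q)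
    (by simp [QSeries.exponent, ← PowerSeries.coeff_zero_eq_constantCoeff_apply]) ?_
  · rw [QSeries.formalExp, ← h]
    ext r
    simp only [QSeries.genSeries, PowerSeries.coeff_mk]
    split_ifs with hr
    · subst hr
      rw [tsum_eq_single ∅ (fun t ht => by simp [Finset.card_eq_zero, ht])]
      simp
    · rw [QSeries.A, (hA r).tsum_eq, ← tsum_mul_left]
      refine tsum_congr fun t => ?_
      split_ifs with ht
      · rw [Finset.prod_mul_distrib, Finset.prod_const, ht, pow_mul]
      · simp
  · intro n
    obtain ⟨N, rfl⟩ := Nat.exists_eq_add_of_le' hN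
    obtain ⟨b, hb⟩ : ∃ b, (N + 1) * L = b + 1 := Nat.exists_eq_add_of_le' (Nat.mul_pos (by omega) hL)
    have hL' : (L : ℝ) ≠ 0 := by positivity
    have e1 : N + 2 - 1 = N + 1 := by omega
    have e2 : L * (n + 1) + (N + 1) * L * (n + 1) = (N + 2) * L * (n + 1) := by ring
    -- The three exponents add up to 2((b+1)(n+1)-1), so all signs cancel.
    have hsign : (-1 : ℝ) ^ n * (ε ^ (n + 1) * (-1) ^ ((N + 1) * L * (n + 1) - 1)) = 1 := by
      rw [hε, e1, hb, Nat.add_sub_cancel, ← pow_mul, ← pow_add, ← pow_add]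
      refine Even.neg_one_pow ⟨(b + 1) * (n + 1) - 1, ?_⟩
      have : (b + 1) * (n + 1) = b * (n + 1) + n + 1 := by ring
      omega
    simp_rw [mul_pow]
    rw [tsum_mul_left, (QSeries.hasSum_factor_pow hN hL (Nat.succ_pos n) hq).tsum_eq, e1,
      QSeries.binomConst_eq (Nat.mul_pos hL (Nat.succ_pos n))
        (Nat.mul_pos (Nat.mul_pos (by omega) hL) (Nat.succ_pos n)), e2]
    simp only [QSeries.exponent, PowerSeries.coeff_mk, Nat.succ_ne_zero, if_false, e1]
    set S := ∑ k ∈ Finset.Icc 2 ((N + 2) * L * (n + 1)),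
      QSeries.C (k - 2) (L * (n + 1)) ((N + 1) * L * (n + 1)) * QSeries.G k q
    have hc : ((((N + 2) * L * (n + 1)).choose (L * (n + 1)) : ℕ) : ℝ) ≠ 0 := by
      rw [← e2]
      exact_mod_cast (Nat.choose_pos (by omega)).ne'
    set c : ℝ := ((((N + 2) * L * (n + 1)).choose (L * (n + 1)) : ℕ) : ℝ)
    set sg : ℝ := (-1 : ℝ) ^ ((N + 1) * L * (n + 1) - 1)
    have hR : ∀ u v : ℝ, (-1) ^ n * (ε ^ (n + 1) * (sg * u / c * v)) = u / c * v := fun u v => by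
      linear_combination (u / c * v) * hsign
    rw [hR]
    push_cast
    have : (N : ℝ) + 2 - 1 = N + 1 := by ring
    rw [this]
    field_simp
    ring
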